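/- **Theorem 5.4 (topological origin, case $E^\theta\cap E^{-\theta}$).** Let $\gamma>0$ and $\theta\in\mathbb R$, and put $$\alpha=\frac{\gamma}{1-e^{-\gamma}}-\frac{\gamma}{1-e^{\gamma}},\qquad \eta=\frac{-\gamma}{1-e^{-\gamma}},\qquad \beta=\frac{\gamma}{1-e^{\gamma}}.$$ For $N\ge 1$ let $C^\gamma\in\mathbb R^{2N\times 2N}$ be the tridiagonal matrix with diagonal entries $C^\gamma_{11}=C^\gamma_{2N,2N}=\alpha+\beta$ and $C^\gamma_{ii}=\alpha$ for $1<i<2N$, and with off-diagonal entries $C^\gamma_{i,i-1}=\beta$, $C^\gamma_{i,i+1}=\eta$ for $i\le N$ and $C^\gamma_{i,i-1}=\eta$, $C^\gamma_{i,i+1}=\beta$ for $i\ge N+1$ (whenever the indices lie in $\{1,\dots,2N\}$). Let $\mathcal C^{\theta,\gamma}=V^\theta C^\gamma$, where $V^\theta=\operatorname{diag}(e^{\mathrm i\theta},\dots,e^{\mathrm i\theta},e^{-\mathrm i\theta},\dots,e^{-\mathrm i\theta})$ with $N$ entries of each kind. Define $f^\theta_\pm:S^1\to\mathbb C$ by $$f_\pm^\theta(e^{\mathrm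 i\phi})=e^{\pm\mathrm i\theta}\left(\beta e^{\pm\mathrm i\phi}+\alpha+\eta e^{\mp\mathrm i\phi}\right)$$ and the regions $$E^{\theta}=\{z\in\mathbb C:\operatorname{wind}(f^\theta_+,z)<0\},\qquad E^{-\theta}=\{z\in\mathbb C:-\operatorname{wind}(f^\theta_-,z)<0\},$$ where $\operatorname{wind}(f,z)$ is the winding number of the closed curve $f$ around a point $z$ not on it (points on the curve do not belong to the region). Suppose that $\lambda\in E^\theta\cap E^{-\theta}$. Then there are $\rho\in(0,1)$, constants $C_1,C_2,C_3>0$ and $N_0\in\mathbb N$, all independent of $N$, such that for every $N\ge N_0$ there is a nonzero vector $\boldsymbol v\in\mathbb C^{2N}$ with $$\frac{\lVert(\mathcal C^{\theta,\gamma}-\lambda I)\boldsymbol v\rVert_2}{\lVert\boldsymbol v\rVert_2}\le\max(C_1,NC_2)\,\rho^{N-1}$$ and $$\frac{|\boldsymbol v_j|}{\max_i|\boldsymbol v_i|}\le C_3N\rho^{j-1}\quad(1\le j\le N),\qquad \frac{|\boldsymbol v_j|}{\max_i|\boldsymbol v_i|}\le C_3N\rho^{2N-j}\quad(N+1\le j\le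 2N).$$ -/

import Mathlib

open scoped Matrix

noncomputable section

namespace GaugeCapacitance

/-! ### The generalised gauge capacitance matrix -/

/-- `α = γ / (1 - e^{-γ}) - γ / (1 - e^{γ}) = γ coth (γ / 2)`. -/
def alpha (γ : ℝ) : ℝ := γ / (1 - Real.exp (-γ)) - γ / (1 - Real.exp γ)

/-- `η = -γ / (1 - e^{-γ})`. -/
def eta (γ : ℝ) : ℝ := -γ / (1 - Real.exp (-γ))

/-- `β = γ / (1 - e^{γ})`. -/
def beta (γ : ℝ) : ℝ := γ / (1 - Real.exp γ)

/-- The gauge capacitance matrix `C^γ`, of size `2N × 2N` (indices start at `0`): it is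
tridiagonal, with `α` on the diagonal except for the two corner entries `α + β`; the first `N`
rows have `β` to the left and `η` to the right of the diagonal, and the last `N` rows have
`η` to the left and `β` to the right of it. -/
def gaugeMatrix (γ : ℝ) (N : ℕ) : Matrix (Fin (2 * N)) (Fin (2 * N)) ℝ :=
  Matrix.of fun i j =>
    if (j : ℕ) = i then
      (if (i : ℕ) = 0 ∨ (i : ℕ) + 1 = 2 * N then alpha γ + beta γ else alpha γ)
    else if (j : ℕ) = i + 1 then
      (if (i : ℕ) < N then eta γ else beta γ)
    else if (j : ℕ) + 1 = i then
      (if (i : ℕ) < N then beta γ else eta γ)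
    else 0

/-- The diagonal matrix `V^θ` with entries `e^{iθ}` (first `N`) and `e^{-iθ}` (last `N`). -/
def materialMatrix (θ : ℝ) (N : ℕ) : Matrix (Fin (2 * N)) (Fin (2 * N)) ℂ :=
  Matrix.diagonal fun i =>
    if (i : ℕ) < N then Complex.exp (Complex.I * θ) else Complex.exp (-(Complex.I * θ))

/-- The generalised gauge capacitance matrix `𝒞^{θ,γ} = V^θ C^γ`. -/
def genGaugeMatrix (θ γ : ℝ) (N : ℕ) : Matrix (Fin (2 * N)) (Fin (2 * N)) ℂ :=
  materialMatrix θ N * (gaugeMatrix γ N).map Complex.ofReal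

/-! ### Winding numbers -/

/-- The closed curve `t ↦ f (e^{it})`, `0 ≤ t ≤ 2π`, avoids `z` and winds `n` times around it:
`f (e^{it}) - z` has a continuous logarithm `g` along `[0, 2π]`, and the increment of `g`
over `[0, 2π]` is `2πi n`. -/
def HasWindingNumber (f : Circle → ℂ) (z : ℂ) (n : ℤ) : Prop :=
  ∃ g : ℝ → ℂ, ContinuousOn g (Set.Icc 0 (2 * Real.pi)) ∧
    (∀ t ∈ Set.Icc (0 : ℝ) (2 * Real.pi), Complex.exp (g t) = f (Circle.exp t) - z) ∧
    g (2 * Real.pi) - g 0 = n * (2 * Real.pi * Complex.I)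

/-- The winding number is well defined. -/
theorem HasWindingNumber.unique {f : Circle → ℂ} {z : ℂ} {m n : ℤ}
    (hm : HasWindingNumber f z m) (hn : HasWindingNumber f z n) : m = n := by
  obtain ⟨g, hg, hge, hgi⟩ := hm
  obtain ⟨h, hh, hhe, hhi⟩ := hn
  have h2 : (2 * Real.pi * Complex.I : ℂ) ≠ 0 := Complex.two_pi_I_ne_zero
  have hpi := Real.pi_pos
  have key : ∀ t ∈ Set.Icc (0 : ℝ) (2 * Real.pi), ∃ k : ℤ,
      (k : ℂ) = (g t - h t) / (2 * Real.pi * Complex.I) := by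
    intro t ht
    obtain ⟨k, hk⟩ := Complex.exp_eq_exp_iff_exists_int.1 ((hge t ht).trans (hhe t ht).symm)
    refine ⟨k, ?_⟩
    rw [hk]
    field_simp
    ring
  have hc : ContinuousOn (fun t => ((g t - h t) / (2 * Real.pi * Complex.I)).re)
      (Set.Icc 0 (2 * Real.pi)) :=
    Complex.continuous_re.comp_continuousOn ((hg.sub hh).div_const _)
  have hconst := isPreconnected_Icc.constant_of_mapsTo
    (T := Set.range ((↑) : ℤ → ℝ))
    Int.isClosedEmbedding_coe_real.isEmbedding.isInducing.isDiscrete_range hc (by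
      intro t ht
      obtain ⟨k, hk⟩ := key t ht
      exact ⟨k, by simp [← hk]⟩)
    (x := 0) (y := 2 * Real.pi) ⟨le_rfl, by positivity⟩ ⟨by positivity, le_rfl⟩
  obtain ⟨a, ha⟩ := key 0 ⟨le_rfl, by positivity⟩
  obtain ⟨b, hb⟩ := key (2 * Real.pi) ⟨by positivity, le_rfl⟩
  simp only [← ha, ← hb, Complex.intCast_re] at hconst
  have hab : (a : ℂ) = b := by exact_mod_cast hconst
  rw [ha, hb, div_left_inj' h2] at hab
  have : (m : ℂ) * (2 * Real.pi * Complex.I) = n * (2 * Real.pi * Complex.I) := by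
    rw [← hgi, ← hhi]
    linear_combination -hab
  exact_mod_cast mul_right_cancel₀ h2 this

open Classical in
/-- The winding number `wind(f, z)` of the closed curve `f` around `z`
(with the value `0` when it is undefined, for instance when `z` lies on the curve). -/
def wind (f : Circle → ℂ) (z : ℂ) : ℤ :=
  if h : ∃ n : ℤ, HasWindingNumber f z n then h.choose else 0

/-! ### Symbols and regions of topological convergence -/

/-- The upper symbol `e^{iφ} ↦ e^{iθ} (β e^{iφ} + α + η e^{-iφ})`. -/
def upperSymbol (θ γ : ℝ) (w : Circle) : ℂ :=
  Complex.exp (Complex.I * θ) * (beta γ * (w : ℂ) + alpha γ + eta γ * ((w⁻¹ : Circle) : ℂ))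

/-- The lower symbol `e^{iφ} ↦ e^{-iθ} (β e^{-iφ} + α + η e^{iφ})`. -/
def lowerSymbol (θ γ : ℝ) (w : Circle) : ℂ :=
  Complex.exp (-(Complex.I * θ)) * (beta γ * ((w⁻¹ : Circle) : ℂ) + alpha γ + eta γ * (w : ℂ))

/-- The upper region of topological convergence `E^θ = {z | wind(f_+^θ, z) < 0}`. -/
def upperRegion (θ γ : ℝ) : Set ℂ := {z | wind (upperSymbol θ γ) z < 0}

/-- The lower region of topological convergence `E^{-θ} = {z | -wind(f_-^θ, z) < 0}`. -/
def lowerRegion (θ γ : ℝ) : Set ℂ := {z | -wind (lowerSymbol θ γ) z < 0}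

end GaugeCapacitance

end

/-! On the circle the upper symbol minus `z` equals `e^{iθ} η w⁻¹ (1 - r w)(1 - s w)` with `r s = β
/ η = e^{-γ}`, so at most one of `r`, `s` lies outside the open disc. If exactly one does, the
winding number is `0`; if one lies on the unit circle, the curve meets `z`. A nonzero winding number
therefore puts both `r` and `s` inside (`exists_roots_of_hasWindingNumber`), and every solution of
the bulk recurrence decays. This leaves `u 1` free to satisfy the corner row.

The lower half is the same problem with `-θ`: reversing the indices turns `𝒞^{θ,γ}` into `𝒞^{-θ,γ}`,
and `w ↦ w⁻¹` turns the lower symbol into the upper one. The two half-line solutions, glued back to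
back, fail the eigenvalue equation only in the two middle rows, where they are already exponentially
small. -/

/-! ### Second-order recurrences and a norm bound -/

theorem exists_add_eq_and_mul_eq (p c : ℂ) : ∃ r s : ℂ, r + s = p ∧ r * s = c := by
  obtain ⟨d, hd⟩ := IsAlgClosed.exists_eq_mul_self (p ^ 2 - 4 * c)
  exact ⟨(p + d) / 2, (p - d) / 2, by ring, by linear_combination hd / 4⟩

/-- Second-order recurrences whose characteristic roots lie in the open unit disc have a solution
that starts with prescribed values and decays geometrically, up to a linear factor. -/
theorem exists_decaying_recurrence {r s : ℂ} (hr : ‖r‖ < 1) (hs : ‖s‖ < 1) (u₁ : ℂ) :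
    ∃ u : ℕ → ℂ, u 0 = 1 ∧ u 1 = u₁ ∧ (∀ n, u (n + 2) = (r + s) * u (n + 1) - r * s * u n) ∧
      ∃ ρ : ℝ, 0 < ρ ∧ ρ < 1 ∧ ∃ K : ℝ, 0 < K ∧ ∀ n : ℕ, ‖u n‖ ≤ K * (n + 1) * ρ ^ n := by
  -- The recurrence factors into two first-order ones. This avoids dividing by `r - s`, so a double
  -- root needs no separate case; the linear factor in the bound pays for it.
  let u : ℕ → ℂ := fun n => Nat.rec 1 (fun n x => r * x + (u₁ - r) * s ^ n) n
  have hu : ∀ n, u (n + 1) = r * u n + (u₁ - r) * s ^ n := fun _ => rfl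
  have hu0 : u 0 = 1 := rfl
  obtain ⟨ρ, hρ, hρ1⟩ := exists_between (max_lt (max_lt hr hs) one_pos)
  simp only [max_lt_iff] at hρ
  obtain ⟨⟨hrρ, hsρ⟩, hρ0⟩ := hρ
  -- The summand `1` covers `u 0`; the other makes `K * ρ` dominate the forcing coefficient `‖u₁ -
  -- r‖`.
  refine ⟨u, hu0, by simp [hu, hu0], fun n => ?_, ρ, hρ0, hρ1, 1 + ‖u₁ - r‖ / ρ,
    by positivity, fun n => ?_⟩
  · rw [hu (n + 1), hu n]
    ring
  · induction n with
    | zero =>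
      have : 0 ≤ ‖u₁ - r‖ / ρ := by positivity
      simpa [hu0]
    | succ n ih =>
      have hK : ‖u₁ - r‖ ≤ (1 + ‖u₁ - r‖ / ρ) * ρ := by
        rw [add_mul, div_mul_cancel₀ _ hρ0.ne']
        linarith
      set K := 1 + ‖u₁ - r‖ / ρ
      calc ‖u (n + 1)‖ ≤ ‖r‖ * ‖u n‖ + ‖u₁ - r‖ * ‖s‖ ^ n := by
            rw [hu]
            exact (norm_add_le _ _).trans_eq (by simp)
        _ ≤ ρ * (K * (n + 1) * ρ ^ n) + (K * ρ) * ρ ^ n := by gcongr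
        _ = K * ((n + 1 : ℕ) + 1) * ρ ^ (n + 1) := by push_cast; ring

theorem norm_toLp_le_of_eq_zero {ι : Type*} [Fintype ι] [DecidableEq ι] {x : ι → ℂ} {a b : ι}
    (hab : a ≠ b) (hx : ∀ i, i ≠ a → i ≠ b → x i = 0) :
    ‖WithLp.toLp 2 x‖ ≤ ‖x a‖ + ‖x b‖ := by
  have : WithLp.toLp 2 x = EuclideanSpace.single a (x a) + EuclideanSpace.single b (x b) := by
    ext i
    by_cases ha : i = a
    · subst ha; simp [hab]
    · by_cases hb : i = b
      · subst hb; simp [ha]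
      · simp [ha, hb, hx]
  rw [this]
  exact (norm_add_le _ _).trans_eq (by simp)

namespace GaugeCapacitance

/-! ### Signs and ratio of the off-diagonal entries -/

theorem beta_neg {γ : ℝ} (hγ : 0 < γ) : beta γ < 0 :=
  div_neg_of_pos_of_neg hγ (by linarith [Real.one_lt_exp_iff.2 hγ])

theorem eta_eq (γ : ℝ) : eta γ = beta γ * Real.exp γ := by
  unfold eta beta
  rcases eq_or_ne γ 0 with rfl | h
  · simp
  have h1 : 1 - Real.exp γ ≠ 0 := by
    rw [sub_ne_zero, ne_comm, Ne, Real.exp_eq_one_iff]; exact h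
  have h2 : Real.exp γ - 1 ≠ 0 := by rwa [← neg_ne_zero, neg_sub]
  have h3 := Real.exp_ne_zero γ
  rw [Real.exp_neg]
  field_simp
  rw [← neg_sub]
  field_simp

theorem eta_neg {γ : ℝ} (hγ : 0 < γ) : eta γ < 0 := by
  rw [eta_eq]
  exact mul_neg_of_neg_of_pos (beta_neg hγ) (Real.exp_pos γ)

/-! ### Winding numbers of the symbols -/

/-- The logarithm is run backwards, `t ↦ 2π - t`. This reduces the lower symbol to an upper one. -/
theorem hasWindingNumber_comp_inv {f : Circle → ℂ} {z : ℂ} {n : ℤ} (h : HasWindingNumber f z n) :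
    HasWindingNumber (fun w => f w⁻¹) z (-n) := by
  obtain ⟨g, hg, hge, hgi⟩ := h
  have hm : Set.MapsTo (fun t : ℝ => 2 * Real.pi - t) (Set.Icc 0 (2 * Real.pi))
      (Set.Icc 0 (2 * Real.pi)) := fun t ht => ⟨by linarith [ht.2], by linarith [ht.1]⟩
  refine ⟨fun t => g (2 * Real.pi - t), hg.comp (by fun_prop) hm, fun t ht => ?_, ?_⟩
  · rw [hge _ (hm ht)]
    dsimp only
    rw [sub_eq_neg_add (2 * Real.pi), Circle.exp_add_two_pi, Circle.exp_neg]
  · simp only [sub_self, sub_zero]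
    push_cast
    linear_combination -hgi

theorem HasWindingNumber.ne {f : Circle → ℂ} {z : ℂ} {n : ℤ} (h : HasWindingNumber f z n)
    (w : Circle) : f w - z ≠ 0 := by
  obtain ⟨g, -, hge, -⟩ := h
  have hw : Circle.exp (toIcoMod Real.two_pi_pos 0 (Complex.arg w)) = w := by
    rw [toIcoMod, Circle.periodic_exp.sub_zsmul_eq, Circle.exp_arg]
  have ht := toIcoMod_mem_Ico Real.two_pi_pos 0 (Complex.arg w)
  rw [zero_add] at ht
  rw [← hw, ← hge _ (Set.Ico_subset_Icc_self ht)]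
  exact Complex.exp_ne_zero _

/-- A nonzero value cannot be the default `0`, so points of either region are genuinely off the
curve. -/
theorem hasWindingNumber_wind {f : Circle → ℂ} {z : ℂ} (h : wind f z ≠ 0) :
    HasWindingNumber f z (wind f z) := by
  unfold wind at h ⊢
  split_ifs at h ⊢ with hn
  · exact hn.choose_spec
  · exact absurd rfl h

/-- Both factors stay in the disc of radius `1` about `1`, hence in the slit plane, so their
principal logarithms are continuous and return to their initial values. -/
theorem hasWindingNumber_zero_of_eq {f : Circle → ℂ} {z c a b : ℂ} (hc : c ≠ 0) (ha : ‖a‖ < 1)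
    (hb : ‖b‖ < 1)
    (hf : ∀ w : Circle, f w - z = c * ((1 - a * ((w⁻¹ : Circle) : ℂ)) * (1 - b * (w : ℂ)))) :
    HasWindingNumber f z 0 := by
  have slit : ∀ (a : ℂ) (w : Circle), ‖a‖ < 1 → 1 - a * w ∈ Complex.slitPlane := by
    intro a w ha
    have := Complex.mem_slitPlane_of_norm_lt_one (z := -(a * w))
      (by rwa [norm_neg, norm_mul, Circle.norm_coe, mul_one])
    rwa [← sub_eq_add_neg] at this
  refine ⟨fun t => Complex.log c + Complex.log (1 - a * (((Circle.exp t)⁻¹ : Circle) : ℂ))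
    + Complex.log (1 - b * (Circle.exp t : ℂ)), ?_, fun t _ => ?_, ?_⟩
  · refine ((continuous_const.add (Continuous.clog ?_ fun t => slit _ _ ha)).add
      (Continuous.clog ?_ fun t => slit _ _ hb)).continuousOn
    all_goals fun_prop
  · rw [hf, Complex.exp_add, Complex.exp_add, Complex.exp_log hc,
      Complex.exp_log (Complex.slitPlane_ne_zero (slit _ _ ha)),
      Complex.exp_log (Complex.slitPlane_ne_zero (slit _ _ hb)), mul_assoc]
  · simp

/-- If the symbol `e^{iθ} (β w + α + η w⁻¹)` winds around `z`, both solutions of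
`η r² + (α - e^{-iθ} z) r + β = 0` lie in the open unit disc. -/
theorem exists_roots_of_hasWindingNumber {θ γ : ℝ} (hγ : 0 < γ) {z : ℂ} {n : ℤ} (hn : n ≠ 0)
    (h : HasWindingNumber (upperSymbol θ γ) z n) :
    ∃ r s : ℂ, ‖r‖ < 1 ∧ ‖s‖ < 1 ∧ eta γ * (r * s) = beta γ ∧
      eta γ * (r + s) = Complex.exp (-(Complex.I * θ)) * z - alpha γ := by
  have hη : (eta γ : ℂ) ≠ 0 := by exact_mod_cast (eta_neg hγ).ne
  obtain ⟨r, s, hadd, hmul⟩ := exists_add_eq_and_mul_eq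
    ((Complex.exp (-(Complex.I * θ)) * z - alpha γ) / eta γ) (beta γ / eta γ)
  rw [eq_div_iff hη, mul_comm] at hadd hmul
  have hprod : ‖r‖ * ‖s‖ < 1 := by
    have h1 : ‖eta γ * (r * s)‖ = ‖(beta γ : ℂ)‖ := by rw [hmul]
    rw [eta_eq] at h1
    push_cast at h1
    have hβ : 0 < ‖(beta γ : ℂ)‖ := by
      rw [norm_pos_iff]; exact_mod_cast (beta_neg hγ).ne
    rw [norm_mul, norm_mul, norm_mul, mul_assoc, mul_eq_left₀ hβ.ne', Complex.norm_exp,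
      Complex.ofReal_re] at h1
    have h2 := Real.one_lt_exp_iff.2 hγ
    by_contra! h3
    nlinarith
  have hfac : ∀ w : Circle, upperSymbol θ γ w - z =
      Complex.exp (Complex.I * θ) * (eta γ * ((w⁻¹ : Circle) : ℂ)
        * ((1 - r * w) * (1 - s * w))) := by
    intro w
    have hw : ((w⁻¹ : Circle) : ℂ) * w = 1 := by
      rw [← Circle.coe_mul, inv_mul_cancel, Circle.coe_one]
    have he : Complex.exp (Complex.I * θ) * Complex.exp (-(Complex.I * θ)) = 1 := by
      rw [← Complex.exp_add, add_neg_cancel, Complex.exp_zero]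
    unfold upperSymbol
    linear_combination (z * he - Complex.exp (Complex.I * θ) * w * hmul
      + Complex.exp (Complex.I * θ) * hadd
      + Complex.exp (Complex.I * θ) * (eta γ * (r + s) - eta γ * (r * s) * w) * hw)
  have key : ∀ r s : ℂ, ‖r‖ * ‖s‖ < 1 → (∀ w : Circle, upperSymbol θ γ w - z =
      Complex.exp (Complex.I * θ) * (eta γ * ((w⁻¹ : Circle) : ℂ)
        * ((1 - r * w) * (1 - s * w)))) → ‖r‖ < 1 := by
    intro r s hrs hf
    by_contra! hr
    have hr0 : r ≠ 0 := by
      rintro rfl; norm_num at hr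
    rcases hr.eq_or_lt with hr | hr
    · have hc : ‖r⁻¹‖ = 1 := by rw [norm_inv, ← hr, inv_one]
      have := hf ⟨r⁻¹, by simpa [Submonoid.unitSphere] using hc⟩
      refine h.ne _ (this.trans ?_)
      simp [hr0]
    · have hs : ‖s‖ < 1 := by nlinarith [norm_nonneg s]
      refine hn (h.unique (hasWindingNumber_zero_of_eq
        (c := -(Complex.exp (Complex.I * θ) * eta γ * r)) (a := r⁻¹) (b := s) ?_ ?_ hs ?_))
      · simp [hη, hr0]
      · rw [norm_inv]
        exact inv_lt_one_of_one_lt₀ hr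
      · intro w
        have hw : ((w⁻¹ : Circle) : ℂ) * w = 1 := by
          rw [← Circle.coe_mul, inv_mul_cancel, Circle.coe_one]
        have hrr : r * r⁻¹ = 1 := mul_inv_cancel₀ hr0
        rw [hf]
        linear_combination (Complex.exp (Complex.I * θ) * eta γ * (1 - s * w)) *
          (-r * hw - ((w⁻¹ : Circle) : ℂ) * hrr)
  refine ⟨r, s, key r s hprod hfac, key s r (by rwa [mul_comm]) fun w => ?_, hmul, hadd⟩
  rw [hfac, mul_comm (1 - r * (w : ℂ))]

/-! ### Decaying solutions on the half-line -/

/-- `u` solves the half-line problem for the upper block at `z`: it is annihilated by the rows of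
the semi-infinite matrix `T - e^{-iθ} z`, where `T` has the corner entry `α + β`. -/
structure IsHalfLineSolution (θ γ : ℝ) (z : ℂ) (u : ℕ → ℂ) : Prop where
  boundary : (alpha γ + beta γ - Complex.exp (-(Complex.I * θ)) * z) * u 0 + eta γ * u 1 = 0
  interior : ∀ n, beta γ * u n + (alpha γ - Complex.exp (-(Complex.I * θ)) * z) * u (n + 1)
    + eta γ * u (n + 2) = 0

theorem exists_isHalfLineSolution {θ γ : ℝ} (hγ : 0 < γ) {z : ℂ} {n : ℤ} (hn : n ≠ 0)
    (h : HasWindingNumber (upperSymbol θ γ) z n) :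
    ∃ u, IsHalfLineSolution θ γ z u ∧ u 0 = 1 ∧
      ∃ ρ : ℝ, 0 < ρ ∧ ρ < 1 ∧ ∃ K : ℝ, 0 < K ∧ ∀ n : ℕ, ‖u n‖ ≤ K * (n + 1) * ρ ^ n := by
  have hη : (eta γ : ℂ) ≠ 0 := by exact_mod_cast (eta_neg hγ).ne
  obtain ⟨r, s, hr, hs, hmul, hadd⟩ := exists_roots_of_hasWindingNumber hγ hn h
  obtain ⟨u, hu0, hu1, hu, hb⟩ := exists_decaying_recurrence hr hs
    (-(alpha γ + beta γ - Complex.exp (-(Complex.I * θ)) * z) / eta γ)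
  refine ⟨u, ⟨?_, fun n => ?_⟩, hu0, hb⟩
  · rw [hu0, hu1]
    field_simp
    ring
  · rw [hu]
    linear_combination hadd * u (n + 1) - hmul * u n

theorem exists_isHalfLineSolution_of_mem_upperRegion {θ γ : ℝ} (hγ : 0 < γ) {z : ℂ}
    (hz : z ∈ upperRegion θ γ) :
    ∃ u, IsHalfLineSolution θ γ z u ∧ u 0 = 1 ∧
      ∃ ρ : ℝ, 0 < ρ ∧ ρ < 1 ∧ ∃ K : ℝ, 0 < K ∧ ∀ n : ℕ, ‖u n‖ ≤ K * (n + 1) * ρ ^ n :=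
  have hz : wind (upperSymbol θ γ) z < 0 := hz
  exists_isHalfLineSolution hγ hz.ne (hasWindingNumber_wind hz.ne)

theorem exists_isHalfLineSolution_of_mem_lowerRegion {θ γ : ℝ} (hγ : 0 < γ) {z : ℂ}
    (hz : z ∈ lowerRegion θ γ) :
    ∃ u, IsHalfLineSolution (-θ) γ z u ∧ u 0 = 1 ∧
      ∃ ρ : ℝ, 0 < ρ ∧ ρ < 1 ∧ ∃ K : ℝ, 0 < K ∧ ∀ n : ℕ, ‖u n‖ ≤ K * (n + 1) * ρ ^ n := by
  have hz : -wind (lowerSymbol θ γ) z < 0 := hz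
  have h := hasWindingNumber_comp_inv (hasWindingNumber_wind (neg_ne_zero.1 hz.ne))
  have hs : (fun w => lowerSymbol θ γ w⁻¹) = upperSymbol (-θ) γ := by
    funext w
    simp [lowerSymbol, upperSymbol]
  rw [hs] at h
  exact exists_isHalfLineSolution hγ hz.ne h

/-! ### The glued vector -/

/-- The vector `(u₀, …, u_{N-1}, w_{N-1}, …, w₀)`. -/
def glue (u w : ℕ → ℂ) (N : ℕ) (j : Fin (2 * N)) : ℂ :=
  if (j : ℕ) < N then u j else w (2 * N - (j + 1))

theorem glue_rev (u w : ℕ → ℂ) (N : ℕ) (j : Fin (2 * N)) : glue u w N j.rev = glue w u N j := by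
  unfold glue
  rw [Fin.val_rev]
  have := j.isLt
  by_cases hj : (j : ℕ) < N
  · rw [if_neg (by omega), if_pos hj]
    congr 1
    omega
  · rw [if_pos (by omega), if_neg hj]

/-- `C^γ` is invariant under reversal of both indices, while `V^θ` has its two phases exchanged.
Only the first `N` rows then need to be computed. -/
theorem genGaugeMatrix_rev (θ γ : ℝ) (N : ℕ) (i j : Fin (2 * N)) :
    genGaugeMatrix θ γ N i.rev j.rev = genGaugeMatrix (-θ) γ N i j := by
  have := i.isLt
  have := j.isLt
  simp only [genGaugeMatrix, materialMatrix, gaugeMatrix, Matrix.diagonal_mul, Matrix.map_apply,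
    Matrix.of_apply, Fin.val_rev]
  congr 1
  · by_cases hi : (i : ℕ) < N
    · rw [if_neg (by omega), if_pos hi]
      simp
    · rw [if_pos (by omega), if_neg hi]
      simp
  · congr 1
    split_ifs <;> first | rfl | omega

theorem genGaugeMatrix_sub_mulVec_rev (θ γ : ℝ) (z : ℂ) (N : ℕ) (u w : ℕ → ℂ) (i : Fin (2 * N)) :
    ((genGaugeMatrix θ γ N - z • (1 : Matrix (Fin (2 * N)) (Fin (2 * N)) ℂ)) *ᵥ glue u w N) i.rev
      = ((genGaugeMatrix (-θ) γ N - z • (1 : Matrix (Fin (2 * N)) (Fin (2 * N)) ℂ)) *ᵥ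
          glue w u N) i := by
  simp only [Matrix.mulVec, dotProduct]
  rw [← Equiv.sum_comp Fin.revPerm]
  refine Finset.sum_congr rfl fun j _ => ?_
  simp [glue_rev, genGaugeMatrix_rev, Matrix.one_apply]

theorem sum_fin_ite_eq {M : Type*} [AddCommMonoid M] (n k : ℕ) (hk : k < n) (f : Fin n → M) :
    ∑ j : Fin n, (if (j : ℕ) = k then f j else 0) = f ⟨k, hk⟩ := by
  have : ∀ j : Fin n, (j : ℕ) = k ↔ j = ⟨k, hk⟩ := fun j => by rw [Fin.ext_iff]
  simp [this]

/-- The first `N` rows act as on the half-line, except that the last of them meets `w (N - 1)` where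
the half-line solution has `u N`. -/
theorem genGaugeMatrix_sub_mulVec {θ γ : ℝ} {z : ℂ} {N : ℕ} {u : ℕ → ℂ} (w : ℕ → ℂ)
    (hu : IsHalfLineSolution θ γ z u) (i : Fin (2 * N)) (hi : (i : ℕ) < N) :
    ((genGaugeMatrix θ γ N - z • (1 : Matrix (Fin (2 * N)) (Fin (2 * N)) ℂ)) *ᵥ glue u w N) i
      = if (i : ℕ) + 1 = N then Complex.exp (Complex.I * θ) * (eta γ * (w (N - 1) - u N))
        else 0 := by
  have he : Complex.exp (Complex.I * θ) * Complex.exp (-(Complex.I * θ)) = 1 := by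
    rw [← Complex.exp_add, add_neg_cancel, Complex.exp_zero]
  have hnext : glue u w N ⟨i + 1, by omega⟩ =
      u (i + 1) + if (i : ℕ) + 1 = N then w (N - 1) - u N else 0 := by
    unfold glue
    dsimp only
    split_ifs with h1 h2 h2
    · omega
    · ring
    · rw [h2, show 2 * N - (N + 1) = N - 1 by omega]
      ring
    · omega
  have hself : glue u w N i = u i := if_pos hi
  -- The left neighbour stays a sum because row `0` has none; the sum is then empty of nonzero
  -- terms.
  have hrow : ((genGaugeMatrix θ γ N - z • (1 : Matrix (Fin (2 * N)) (Fin (2 * N)) ℂ)) *ᵥ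
      glue u w N) i = Complex.exp (Complex.I * θ) *
        (((if (i : ℕ) = 0 then alpha γ + beta γ else alpha γ : ℝ) : ℂ) * glue u w N i
          + eta γ * glue u w N ⟨i + 1, by omega⟩
          + ∑ j : Fin (2 * N), if (j : ℕ) + 1 = i then beta γ * glue u w N j else 0)
        - z * glue u w N i := by
    rw [Matrix.sub_mulVec, Matrix.smul_mulVec, Matrix.one_mulVec, Pi.sub_apply, Pi.smul_apply,
      smul_eq_mul, ← sum_fin_ite_eq (2 * N) i i.isLt fun j =>
        ((if (i : ℕ) = 0 then alpha γ + beta γ else alpha γ : ℝ) : ℂ) * glue u w N j,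
      ← sum_fin_ite_eq (2 * N) (i + 1) (by omega) fun j => eta γ * glue u w N j,
      ← Finset.sum_add_distrib, ← Finset.sum_add_distrib, Finset.mul_sum]
    congr 1
    simp only [Matrix.mulVec, dotProduct]
    refine Finset.sum_congr rfl fun j _ => ?_
    have hlast : (i : ℕ) + 1 ≠ 2 * N := by omega
    simp only [genGaugeMatrix, materialMatrix, gaugeMatrix, Matrix.diagonal_mul, Matrix.map_apply,
      Matrix.of_apply, if_pos hi, hlast, or_false]
    by_cases h1 : (j : ℕ) = i
    · simp [h1, mul_assoc]
    · by_cases h2 : (j : ℕ) = i + 1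
      · have h3 : ¬ (i : ℕ) + 1 + 1 = i := by omega
        simp [h2, h3, mul_assoc]
      · by_cases h3 : (j : ℕ) + 1 = i
        · simp [h1, h2, h3, mul_assoc]
        · simp [h1, h2, h3]
  rw [hrow, hnext, hself]
  rcases Nat.eq_zero_or_pos i with h0 | h0
  · have hsum : ∑ j : Fin (2 * N), (if (j : ℕ) + 1 = i then beta γ * glue u w N j else 0) = 0 :=
      Finset.sum_eq_zero fun j _ => if_neg (by omega)
    have hb := hu.boundary
    rw [hsum, h0, if_pos rfl]
    push_cast
    split_ifs
    all_goals linear_combination Complex.exp (Complex.I * θ) * hb + z * u 0 * he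
  · obtain ⟨k, hk⟩ : ∃ k, (i : ℕ) = k + 1 := ⟨i - 1, by omega⟩
    have hsum : ∑ j : Fin (2 * N), (if (j : ℕ) + 1 = i then beta γ * glue u w N j else 0)
        = beta γ * u k := by
      simp only [hk, Nat.add_right_cancel_iff]
      rw [sum_fin_ite_eq (2 * N) k (by omega)]
      rw [glue, if_pos (show k < N by omega)]
    have hb := hu.interior k
    rw [hsum, hk, if_neg (by omega)]
    split_ifs
    all_goals linear_combination Complex.exp (Complex.I * θ) * hb + z * u (k + 1) * he

theorem norm_exp_I_mul (θ : ℝ) : ‖Complex.exp (Complex.I * θ)‖ = 1 := by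
  rw [mul_comm, Complex.norm_exp_ofReal_mul_I]

theorem norm_genGaugeMatrix_sub_mulVec_glue_le {θ γ : ℝ} {z : ℂ} {N : ℕ} (hN : 1 ≤ N)
    {u w : ℕ → ℂ} (hu : IsHalfLineSolution θ γ z u) (hw : IsHalfLineSolution (-θ) γ z w) :
    ‖WithLp.toLp 2 ((genGaugeMatrix θ γ N
        - z • (1 : Matrix (Fin (2 * N)) (Fin (2 * N)) ℂ)) *ᵥ glue u w N)‖
      ≤ |eta γ| * (‖w (N - 1)‖ + ‖u N‖) + |eta γ| * (‖u (N - 1)‖ + ‖w N‖) := by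
  set x := (genGaugeMatrix θ γ N
    - z • (1 : Matrix (Fin (2 * N)) (Fin (2 * N)) ℂ)) *ᵥ glue u w N with hx
  let a : Fin (2 * N) := ⟨N - 1, by omega⟩
  have hup := genGaugeMatrix_sub_mulVec (N := N) w hu
  have hlow : ∀ i : Fin (2 * N), (i : ℕ) < N → x i.rev = _ := fun i hi =>
    (genGaugeMatrix_sub_mulVec_rev θ γ z N u w i).trans (genGaugeMatrix_sub_mulVec u hw i hi)
  have haN : (a : ℕ) < N := by simp only [a]; omega
  have haN1 : (a : ℕ) + 1 = N := by simp only [a]; omega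
  have hne : a ≠ a.rev := by
    rw [Ne, Fin.ext_iff, Fin.val_rev]
    omega
  refine (norm_toLp_le_of_eq_zero hne fun i hi hi' => ?_).trans ?_
  · rw [Ne, Fin.ext_iff] at hi hi'
    rw [Fin.val_rev] at hi'
    by_cases h : (i : ℕ) < N
    · rw [hx, hup i h, if_neg (by omega)]
    · rw [← Fin.rev_rev i, hlow i.rev (by rw [Fin.val_rev]; omega),
        if_neg (by rw [Fin.val_rev]; omega)]
  · rw [hlow a haN, hx, hup a haN, if_pos haN1, if_pos haN1]
    simp only [norm_mul, norm_exp_I_mul, one_mul, Complex.norm_real, Real.norm_eq_abs]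
    gcongr
    all_goals exact norm_sub_le _ _

end GaugeCapacitance

/-! ### Assembly of the estimates -/

open GaugeCapacitance in
theorem theorem5p4 (θ γ : ℝ) (hγ : 0 < γ) (lam : ℂ)
    (hlam : lam ∈ GaugeCapacitance.upperRegion θ γ ∩ GaugeCapacitance.lowerRegion θ γ) :
    ∃ ρ : ℝ, 0 < ρ ∧ ρ < 1 ∧ ∃ C₁ C₂ C₃ : ℝ, 0 < C₁ ∧ 0 < C₂ ∧ 0 < C₃ ∧
      ∃ N₀ : ℕ, ∀ N : ℕ, N₀ ≤ N → ∃ v : Fin (2 * N) → ℂ, v ≠ 0 ∧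
        ‖WithLp.toLp 2 ((GaugeCapacitance.genGaugeMatrix θ γ N
            - lam • (1 : Matrix (Fin (2 * N)) (Fin (2 * N)) ℂ)) *ᵥ v)‖ / ‖WithLp.toLp 2 v‖
          ≤ max C₁ (N * C₂) * ρ ^ (N - 1) ∧
        (∀ j : Fin (2 * N), (j : ℕ) < N →
          ‖v j‖ / (⨆ i, ‖v i‖) ≤ C₃ * N * ρ ^ (j : ℕ)) ∧
        (∀ j : Fin (2 * N), N ≤ (j : ℕ) →
          ‖v j‖ / (⨆ i, ‖v i‖) ≤ C₃ * N * ρ ^ (2 * N - ((j : ℕ) + 1))) := by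
  obtain ⟨u, hu, hu0, ρ₁, hρ₁, hρ₁', K₁, hK₁, hub⟩ :=
    exists_isHalfLineSolution_of_mem_upperRegion hγ hlam.1
  obtain ⟨w, hw, -, ρ₂, hρ₂, hρ₂', K₂, hK₂, hwb⟩ :=
    exists_isHalfLineSolution_of_mem_lowerRegion hγ hlam.2
  obtain ⟨ρ, hρdef⟩ : ∃ ρ, ρ = max ρ₁ ρ₂ := ⟨_, rfl⟩
  obtain ⟨K, hKdef⟩ : ∃ K, K = max K₁ K₂ := ⟨_, rfl⟩
  have hρ0 : 0 < ρ := hρdef ▸ lt_max_of_lt_left hρ₁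
  have hρ1 : ρ < 1 := hρdef ▸ max_lt hρ₁' hρ₂'
  have hK : 0 < K := hKdef ▸ lt_max_of_lt_left hK₁
  have hub : ∀ n : ℕ, ‖u n‖ ≤ K * (n + 1) * ρ ^ n := fun n => (hub n).trans <| by
    gcongr
    exacts [hKdef ▸ le_max_left _ _, hρdef ▸ le_max_left _ _]
  have hwb : ∀ n : ℕ, ‖w n‖ ≤ K * (n + 1) * ρ ^ n := fun n => (hwb n).trans <| by
    gcongr
    exacts [hKdef ▸ le_max_right _ _, hρdef ▸ le_max_right _ _]
  have hη : 0 < |eta γ| := abs_pos.2 (eta_neg hγ).ne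
  -- Each of the two middle rows contributes at most `|η| (1 + 2) K N ρ^(N-1)`, the `2` coming from
  -- `N + 1 ≤ 2 N`; hence `6 K |η|`. `C₁` plays no role and is set to `1`.
  refine ⟨ρ, hρ0, hρ1, 1, 6 * K * |eta γ|, K, one_pos, by positivity, hK, 1, fun N hN => ?_⟩
  have hN1 : (1 : ℝ) ≤ N := by exact_mod_cast hN
  let o : Fin (2 * N) := ⟨0, by omega⟩
  -- The normalisation `u 0 = 1` bounds both denominators below by `1`, so they can be dropped.
  have hv0 : glue u w N o = 1 := (if_pos (show 0 < N by omega)).trans hu0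
  have hsup : 1 ≤ ⨆ i, ‖glue u w N i‖ := by
    simpa [hv0] using le_ciSup (f := fun i => ‖glue u w N i‖) (Set.finite_range _).bddAbove o
  have hnorm : 1 ≤ ‖WithLp.toLp 2 (glue u w N)‖ := by
    simpa [hv0] using PiLp.norm_apply_le (WithLp.toLp 2 (glue u w N)) o
  refine ⟨glue u w N, fun h => by simp [h] at hv0, ?_, fun j hj => ?_, fun j hj => ?_⟩
  · refine (div_le_self (norm_nonneg _) hnorm).trans <|
      (norm_genGaugeMatrix_sub_mulVec_glue_le hN hu hw).trans ?_
    have hprev : ∀ y : ℕ → ℂ, (∀ n : ℕ, ‖y n‖ ≤ K * (n + 1) * ρ ^ n) →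
        ‖y (N - 1)‖ ≤ K * N * ρ ^ (N - 1) ∧ ‖y N‖ ≤ 2 * (K * N * ρ ^ (N - 1)) := by
      intro y hy
      refine ⟨by simpa [Nat.cast_sub hN] using hy (N - 1), (hy N).trans ?_⟩
      calc K * (N + 1) * ρ ^ N ≤ K * (N + N) * ρ ^ (N - 1) := by
            gcongr K * (_ + ?_) * ?_
            exact pow_le_pow_of_le_one hρ0.le hρ1.le (Nat.sub_le _ _)
        _ = 2 * (K * N * ρ ^ (N - 1)) := by ring
    obtain ⟨hu1, hu2⟩ := hprev u hub
    obtain ⟨hw1, hw2⟩ := hprev w hwb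
    calc |eta γ| * (‖w (N - 1)‖ + ‖u N‖) + |eta γ| * (‖u (N - 1)‖ + ‖w N‖)
        ≤ |eta γ| * (K * N * ρ ^ (N - 1) + 2 * (K * N * ρ ^ (N - 1)))
          + |eta γ| * (K * N * ρ ^ (N - 1) + 2 * (K * N * ρ ^ (N - 1))) := by gcongr
      _ = N * (6 * K * |eta γ|) * ρ ^ (N - 1) := by ring
      _ ≤ max 1 (N * (6 * K * |eta γ|)) * ρ ^ (N - 1) := by
          gcongr
          exact le_max_right _ _
  · refine (div_le_self (norm_nonneg _) hsup).trans ?_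
    rw [glue, if_pos hj]
    refine (hub j).trans ?_
    gcongr
    exact_mod_cast hj
  · refine (div_le_self (norm_nonneg _) hsup).trans ?_
    rw [glue, if_neg (by omega)]
    refine (hwb _).trans ?_
    gcongr
    have := j.isLt
    exact_mod_cast (by omega : 2 * N - ((j : ℕ) + 1) + 1 ≤ N)
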